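/- Let $p$ be an odd prime, $k\ge 0$ an integer and $N=p^k$. Write $\mathbb Z_N=\mathbb Z/N\mathbb Z$ and $e(x)=e^{2\pi i x}$, let $L^2(\mathbb Z_N)$ be the space of functions $\psi:\mathbb Z_N\to\mathbb C$ with $\|\psi\|_2^2=\frac1N\sum_{x\in\mathbb Z_N}|\psi(x)|^2$, and put $\|\psi\|_\infty=\max_{x\in\mathbb Z_N}|\psi(x)|$. Let $r$ be a unit of $\mathbb Z_N$ and let $U_N$ be the Weil representation of $SL(2,\mathbb Z_N)$ on $L^2(\mathbb Z_N)$ with parameter $r$, that is, the representation given on generators by $$U_N\begin{pmatrix}1&b\\0&1\end{pmatrix}\psi(x)=e\!\left(\tfrac{rbx^2}{N}\right)\psi(x),\qquad U_N\begin{pmatrix}t&0\\0&t^{-1}\end{pmatrix}\psi(x)=\Lambda(t)\psi(tx),\qquad U_N\begin{pmatrix}0&1\\-1&0\end{pmatrix}\psi(x)=\frac{S_r(-1,N)}{\sqrt N}\sum_{y\in\mathbb Z_N}\psi(y)\,e\!\left(\tfrac{2rxy}{N}\right),$$ where $b\in\mathbb Z_N$, $t\in\mathbb Z_N^\times$, $S_r(a,N)=\frac1{\sqrt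 N}\sum_{y\in\mathbb Z_N}e\!\left(-\tfrac{ray^2}{N}\right)$ and $\Lambda(t)=S_r(-t,N)/S_r(-1,N)$. Let $A\in SL(2,\mathbb Z)$ satisfy $|\operatorname{tr}A|>2$ and have odd diagonal and even off-diagonal entries. The Hecke operators of $A$ are the operators $U_N(g)$ for all $g=xI+yA\in SL(2,\mathbb Z_N)$ with $x,y\in\mathbb Z_N$ and $\det g=1$, and a Hecke eigenfunction is a nonzero $\psi\in L^2(\mathbb Z_N)$ that is an eigenfunction of every Hecke operator of $A$. Then there exists a Hecke eigenfunction $\psi\in L^2(\mathbb Z_N)$ such that $\|\psi\|_2=1$ and $$\|\psi\|_\infty\ \ge\ p^{[k/2]/2},$$ where $[k/2]$ denotes the integer part of $k/2$. -/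

import Mathlib

open Matrix
open scoped MatrixGroups

namespace CatMap

noncomputable section

/-- The additive character `e(x / N) = exp (2 π i x / N)` of `ℤ / N`; the argument `x` is the
numerator, so `e(r b x² / N)` is written `e (r * b * x ^ 2)`. -/
def e {N : ℕ} [NeZero N] (x : ZMod N) : ℂ := ZMod.stdAddChar x

/-- The normalised quadratic Gauss sum `S_r(a, N) = N^{-1/2} ∑_y e(- r a y² / N)`. -/
def gaussS {N : ℕ} [NeZero N] (r : (ZMod N)ˣ) (a : ZMod N) : ℂ :=
  (1 / (Real.sqrt N : ℂ)) * ∑ y : ZMod N, e (-((r : ZMod N) * a * y ^ 2))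

/-- The integral kernel by which the Weil representation acts for matrices
`g = (a, b; c, d)` whose lower left entry `c` is a unit modulo `N`. -/
def bigCell {N : ℕ} [NeZero N] (r : (ZMod N)ˣ) (g : SL(2, ZMod N)) :
    Matrix (ZMod N) (ZMod N) ℂ :=
  Matrix.of fun x y => gaussS r (g 1 0) / (Real.sqrt N : ℂ) *
    e ((r : ZMod N) * (g 1 0)⁻¹ * (g 0 0 * x ^ 2 - 2 * x * y + g 1 1 * y ^ 2))

/-- The matrix `n_b = (1, b; 0, 1)`. -/
def nMat {N : ℕ} (b : ZMod N) : SL(2, ZMod N) := ⟨!![1, b; 0, 1], by simp [det_fin_two]⟩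

/-- The matrix `a_t = (t, 0; 0, t⁻¹)`. -/
def aMat {N : ℕ} (t : (ZMod N)ˣ) : SL(2, ZMod N) :=
  ⟨!![(t : ZMod N), 0; 0, ((t⁻¹ : (ZMod N)ˣ) : ZMod N)], by simp [det_fin_two]⟩

/-- The matrix `ω = (0, 1; -1, 0)`. -/
def omegaMat {N : ℕ} : SL(2, ZMod N) := ⟨!![0, 1; -1, 0], by simp [det_fin_two]⟩

open Classical in
/-- The matrix of `U_N(g)`: the big cell kernel if `c` is a unit, and
`U_N(ω)⁻¹ U_N(ω g)` otherwise (for odd prime powers `N` the lower left entry `-a` of `ω g` is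
then a unit). For odd prime powers this is the Weil representation, see `weilRep`,
`weilRep_nMat`, `weilRep_aMat` and `weilRep_omegaMat`. -/
def weilMatrix {N : ℕ} [NeZero N] (r : (ZMod N)ˣ) (g : SL(2, ZMod N)) :
    Matrix (ZMod N) (ZMod N) ℂ :=
  if IsUnit (g 1 0) then bigCell r g
  else bigCell r omegaMat⁻¹ * bigCell r (omegaMat * g)

/-! The multiplicativity of `weilMatrix` for odd prime powers `N`. -/

section general
set_option linter.unusedSectionVars false
variable {N : ℕ} [NeZero N]

lemma e_add (x y : ZMod N) : e (x + y) = e x * e y := AddChar.map_add_eq_mul _ _ _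

lemma e_zero : e (0 : ZMod N) = 1 := AddChar.map_zero_eq_one _

lemma sum_e (b : ZMod N) : ∑ y : ZMod N, e (y * b) = if b = 0 then (N : ℂ) else 0 := by
  have := AddChar.sum_mulShift b (ZMod.isPrimitive_stdAddChar N)
  simp only [e, this, ZMod.card]
  push_cast; rfl

lemma sqrt_ne : (Real.sqrt N : ℂ) ≠ 0 := by
  have : (0 : ℝ) < N := by exact_mod_cast Nat.pos_of_ne_zero (NeZero.ne N)
  exact_mod_cast (Real.sqrt_pos.mpr this).ne'

lemma sqrt_mul : (Real.sqrt N : ℂ) * (Real.sqrt N : ℂ) = N := by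
  have : (0 : ℝ) ≤ N := by positivity
  exact_mod_cast congrArg (fun x : ℝ => (x : ℂ)) (Real.mul_self_sqrt this)

lemma sum_gauss (r : (ZMod N)ˣ) (a : ZMod N) :
    ∑ y : ZMod N, e ((r : ZMod N) * a * y ^ 2) = (Real.sqrt N : ℂ) * gaussS r (-a) := by
  have := sqrt_ne (N := N)
  unfold gaussS
  field_simp
  refine Finset.sum_congr rfl fun y _ => by congr 1; ring

lemma gaussS_sq (r : (ZMod N)ˣ) (a : ZMod N) (s : (ZMod N)ˣ) :
    gaussS r (a * s ^ 2) = gaussS r a := by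
  unfold gaussS
  congr 1
  refine Fintype.sum_equiv s.mulLeft _ _ fun y => ?_
  simp only [Units.mulLeft_apply]
  congr 1; ring

lemma gaussS_mul_neg (h2 : IsUnit (2 : ZMod N)) (r : (ZMod N)ˣ) (a : (ZMod N)ˣ) :
    gaussS r a * gaussS r (-a) = 1 := by
  obtain ⟨w, hw⟩ := h2
  have key : (∑ y : ZMod N, e (-((r : ZMod N) * (a : ZMod N) * y ^ 2))) * (∑ y : ZMod N, e (-((r : ZMod N) * (-(a : ZMod N)) * y ^ 2)))
      = N := by
    rw [mul_comm, Finset.sum_mul_sum]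
    calc _ = ∑ y : ZMod N, ∑ z : ZMod N, e (y * (-2 * (r : ZMod N) * (a : ZMod N) * z)) *
              e (-((r : ZMod N) * (a : ZMod N) * z ^ 2)) := by
          refine Finset.sum_congr rfl fun y _ => ?_
          refine Fintype.sum_equiv (Equiv.subRight y) _ _ fun z => ?_
          simp only [Equiv.subRight_apply, ← e_add]
          congr 1; ring
      _ = _ := by
          rw [Finset.sum_comm]
          simp_rw [← Finset.sum_mul, sum_e]
          rw [Finset.sum_eq_single 0]
          · simp [e_zero]
          · intro z _ hz
            rw [if_neg, zero_mul]
            intro h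
            apply hz
            have h' : ((-w * r * a : (ZMod N)ˣ) : ZMod N) * z = 0 := by
              push_cast; rw [hw]; exact h
            rwa [Units.mul_right_eq_zero] at h'
          · simp
  unfold gaussS
  have := sqrt_ne (N := N)
  have hs := sqrt_mul (N := N)
  rw [mul_mul_mul_comm, key]
  field_simp
  rw [sq, hs]

lemma inv_eq (u : (ZMod N)ˣ) : (u : ZMod N)⁻¹ = ((u⁻¹ : (ZMod N)ˣ) : ZMod N) :=
  (ZMod.inv_coe_unit u)

lemma det_eq (g : SL(2, ZMod N)) : g 0 0 * g 1 1 - g 0 1 * g 1 0 = 1 := by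
  have := g.2; rwa [det_fin_two] at this

/-- Completing the square. -/
lemma square_aux {R : Type*} [CommRing R] (r a b d a' b' d' C C' C'' ci ci' ci'' x y z : R)
    (i1 : C * ci = 1) (i2 : C' * ci' = 1) (i3 : C'' * ci'' = 1) (e10 : C'' = C * a' + d * C')
    (dg : a * d - b * C = 1) (dh : a' * d' - b' * C' = 1) :
    r * ci * (a * x ^ 2 - 2 * x * y + d * y ^ 2) + r * ci' * (a' * y ^ 2 - 2 * y * z + d' * z ^ 2) =
      r * (C'' * ci * ci') * (y - ci'' * (C' * x + C * z)) ^ 2 +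
        r * ci'' * ((a * a' + b * C') * x ^ 2 - 2 * x * z + (C * b' + d * d') * z ^ 2) := by
  have hd : C'' * ci * ci' = a' * ci' + d * ci := by
    rw [e10]; linear_combination (a' * ci') * i1 + (d * ci) * i2
  have ha : a * ci = ci'' * (a * a' + b * C') + ci * ci'' * C' := by
    linear_combination (-a * ci) * i3 + (ci * a * ci'') * e10 +
      (ci'' * (a * a' + b * C')) * i1 + (ci * ci'' * C') * dg
  have hdd : d' * ci' = ci'' * (C * b' + d * d') + ci' * ci'' * C := by
    linear_combination (-d' * ci') * i3 + (ci' * d' * ci'') * e10 +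
      (ci'' * (C * b' + d * d')) * i2 + (ci' * ci'' * C) * dh
  linear_combination (-r * y ^ 2) * hd + (r * x ^ 2) * ha + (r * z ^ 2) * hdd +
    (2 * r * x * y * ci - r * x ^ 2 * ci * ci'' * C') * (C' * ci' * i3 + i2) +
    (2 * r * y * z * ci' - r * z ^ 2 * ci' * ci'' * C) * (C * ci * i3 + i1) -
    2 * r * x * z * ci'' * (C * ci * C' * ci' * i3 + C' * ci' * i1 + i2)

/-- Composition of two big cell kernels, up to the multiplicativity of Gauss sums. -/
lemma bigCell_mul_aux (r : (ZMod N)ˣ) (g h : SL(2, ZMod N)) (c c' c'' : (ZMod N)ˣ)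
    (hc : g 1 0 = c) (hc' : h 1 0 = c') (hc'' : (g * h) 1 0 = c'')
    (hS : gaussS r c * gaussS r c' * gaussS r (-((c'' * c⁻¹ * c'⁻¹ : (ZMod N)ˣ) : ZMod N))
      = gaussS r c'') :
    bigCell r g * bigCell r h = bigCell r (g * h) := by
  have e00 : (g * h) 0 0 = g 0 0 * h 0 0 + g 0 1 * h 1 0 := by
    simp [Matrix.mul_apply, Fin.sum_univ_two]
  have e10 : (g * h) 1 0 = g 1 0 * h 0 0 + g 1 1 * h 1 0 := by
    simp [Matrix.mul_apply, Fin.sum_univ_two]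
  have e11 : (g * h) 1 1 = g 1 0 * h 0 1 + g 1 1 * h 1 1 := by
    simp [Matrix.mul_apply, Fin.sum_univ_two]
  have dg := det_eq g
  have dh := det_eq h
  ext x z
  rw [Matrix.mul_apply]
  simp only [bigCell, Matrix.of_apply]
  rw [hc, hc', hc'', inv_eq, inv_eq, inv_eq, e00, e11]
  rw [hc''] at e10
  rw [hc] at e10 dg ⊢
  rw [hc'] at e10 dh ⊢
  generalize g 0 0 = a at *
  generalize g 0 1 = b at *
  generalize g 1 1 = d at *
  generalize h 0 0 = a' at *
  generalize h 0 1 = b' at *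
  generalize h 1 1 = d' at *
  have i1 : (c : ZMod N) * ((c⁻¹ : (ZMod N)ˣ) : ZMod N) = 1 := by simp
  have i2 : (c' : ZMod N) * ((c'⁻¹ : (ZMod N)ˣ) : ZMod N) = 1 := by simp
  have i3 : (c'' : ZMod N) * ((c''⁻¹ : (ZMod N)ˣ) : ZMod N) = 1 := by simp
  have hsum : ∑ y : ZMod N, e ((r : ZMod N) * ((c'' * c⁻¹ * c'⁻¹ : (ZMod N)ˣ) : ZMod N) * y ^ 2)
      = (Real.sqrt N : ℂ) * gaussS r (-((c'' * c⁻¹ * c'⁻¹ : (ZMod N)ˣ) : ZMod N)) := sum_gauss r _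
  have hsum2 : ∑ y : ZMod N,
      e ((r : ZMod N) * ((c⁻¹ : (ZMod N)ˣ) : ZMod N) * (a * x ^ 2 - 2 * x * y + d * y ^ 2)) *
        e ((r : ZMod N) * ((c'⁻¹ : (ZMod N)ˣ) : ZMod N) * (a' * y ^ 2 - 2 * y * z + d' * z ^ 2))
      = (∑ y : ZMod N, e ((r : ZMod N) * ((c'' * c⁻¹ * c'⁻¹ : (ZMod N)ˣ) : ZMod N) * y ^ 2)) *
        e ((r : ZMod N) * ((c''⁻¹ : (ZMod N)ˣ) : ZMod N) * ((a * a' + b * (c' : ZMod N)) * x ^ 2 - 2 * x * z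
          + ((c : ZMod N) * b' + d * d') * z ^ 2)) := by
    rw [Finset.sum_mul]
    refine Fintype.sum_equiv (Equiv.subRight
      (((c''⁻¹ : (ZMod N)ˣ) : ZMod N) * (c' * x + c * z))) _ _ fun y => ?_
    simp only [Equiv.subRight_apply, ← e_add]
    push_cast
    congr 1
    generalize ((c⁻¹ : (ZMod N)ˣ) : ZMod N) = ci at *
    generalize ((c'⁻¹ : (ZMod N)ˣ) : ZMod N) = ci' at *
    generalize ((c''⁻¹ : (ZMod N)ˣ) : ZMod N) = ci'' at *
    generalize (c : ZMod N) = C at *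
    generalize (c' : ZMod N) = C' at *
    generalize (c'' : ZMod N) = C'' at *
    exact square_aux _ a b d a' b' d' C C' C'' ci ci' ci'' x y z i1 i2 i3 e10 dg dh
  rw [show ∀ f : ZMod N → ℂ, ∀ g : ZMod N → ℂ, ∀ A B : ℂ, ∑ y, (A * f y) * (B * g y)
    = A * B * ∑ y, f y * g y from fun f g A B => by
      rw [Finset.mul_sum]; exact Finset.sum_congr rfl fun y _ => by ring]
  rw [hsum2, hsum, ← hS]
  have := sqrt_ne (N := N)
  field_simp


/-- Multiplicativity of Gauss sums in the unit coefficient. -/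
def GaussMul (r : (ZMod N)ˣ) : Prop :=
  ∀ u v : (ZMod N)ˣ, gaussS r u * gaussS r v = gaussS r 1 * gaussS r (u * v : (ZMod N)ˣ)

lemma bigCell_mul (h2 : IsUnit (2 : ZMod N)) (r : (ZMod N)ˣ) (hr : GaussMul r)
    (g h : SL(2, ZMod N)) (hg : IsUnit (g 1 0)) (hh : IsUnit (h 1 0))
    (hgh : IsUnit ((g * h) 1 0)) : bigCell r g * bigCell r h = bigCell r (g * h) := by
  obtain ⟨c, hc⟩ := hg
  obtain ⟨c', hc'⟩ := hh
  obtain ⟨c'', hc''⟩ := hgh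
  refine bigCell_mul_aux r g h c c' c'' hc.symm hc'.symm hc''.symm ?_
  have s1 : gaussS r (-((c'' * c⁻¹ * c'⁻¹ : (ZMod N)ˣ) : ZMod N)) =
      gaussS r ((-(c'' * (c * c')) : (ZMod N)ˣ) : ZMod N) := by
    rw [← gaussS_sq r _ (c * c')]
    congr 1
    rw [← Units.val_neg, ← Units.val_pow_eq_pow_val, ← Units.val_mul]
    congr 1
    rw [neg_mul]; congr 1
    rw [sq, mul_assoc c'', ← mul_inv, mul_assoc, inv_mul_cancel_left]
  have s2 := hr (c * c') (-(c'' * (c * c')))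
  have s3 : gaussS r ((c * c' * -(c'' * (c * c')) : (ZMod N)ˣ) : ZMod N) = gaussS r (-(c'' : ZMod N)) := by
    rw [← gaussS_sq r (-(c'' : ZMod N)) (c * c')]
    congr 1
    push_cast; ring
  have s4 := hr 1 (-c'')
  have s5 := hr c c'
  have s6 := hr (-1) c''
  have s7 := gaussS_mul_neg h2 r 1
  rw [s1, s5, mul_assoc, s2, s3]
  rw [neg_one_mul] at s6
  simp only [Units.val_neg, Units.val_one] at s6 s7
  rw [← s6, ← mul_assoc, s7, one_mul]

lemma omega_10 : (omegaMat : SL(2, ZMod N)) 1 0 = -1 := rfl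
lemma mul_10 (g h : SL(2, ZMod N)) :
    (g * h) 1 0 = g 1 0 * h 0 0 + g 1 1 * h 1 0 := by
  simp [Matrix.mul_apply, Fin.sum_univ_two]

lemma inv_00 (g : SL(2, ZMod N)) : (g⁻¹) 0 0 = g 1 1 := by
  simp [Matrix.SpecialLinearGroup.coe_inv, Matrix.adjugate_fin_two]
lemma inv_10 (g : SL(2, ZMod N)) : (g⁻¹) 1 0 = -g 1 0 := by
  simp [Matrix.SpecialLinearGroup.coe_inv, Matrix.adjugate_fin_two]
lemma inv_11 (g : SL(2, ZMod N)) : (g⁻¹) 1 1 = g 0 0 := by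
  simp [Matrix.SpecialLinearGroup.coe_inv, Matrix.adjugate_fin_two]

lemma omega_00 : (omegaMat : SL(2, ZMod N)) 0 0 = 0 := rfl
lemma omega_11 : (omegaMat : SL(2, ZMod N)) 1 1 = 0 := rfl
lemma omegaInv_10 : ((omegaMat : SL(2, ZMod N))⁻¹) 1 0 = 1 := by
  rw [inv_10, omega_10, neg_neg]
lemma omegaInv_00 : ((omegaMat : SL(2, ZMod N))⁻¹) 0 0 = 0 := by rw [inv_00, omega_11]
lemma omegaInv_11 : ((omegaMat : SL(2, ZMod N))⁻¹) 1 1 = 0 := by rw [inv_11, omega_00]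
lemma omega_mul_10 (g : SL(2, ZMod N)) : ((omegaMat * g : SL(2, ZMod N)) 1 0) = -g 0 0 := by
  rw [mul_10, omega_10, omega_11]; ring

/-- Composition of the inverse Fourier transform with a diagonal-type kernel. -/
lemma omegaInv_mul_apply (r : (ZMod N)ˣ) (h2 : IsUnit (2 : ZMod N)) (t : ZMod N) (f : ZMod N → ℂ)
    (x z : ZMod N) :
    (bigCell r omegaMat⁻¹ * (Matrix.of fun y z => e (2 * (r : ZMod N) * t * y * z) * f z) :
      Matrix (ZMod N) (ZMod N) ℂ) x z
      = if z * t = x then (Real.sqrt N : ℂ) * gaussS r 1 * f z else 0 := by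
  obtain ⟨w, hw⟩ := h2
  rw [Matrix.mul_apply]
  simp only [bigCell, Matrix.of_apply, omegaInv_10, omegaInv_00, omegaInv_11]
  calc _ = gaussS r 1 / (Real.sqrt N : ℂ) * f z *
        ∑ y : ZMod N, e (y * (2 * (r : ZMod N) * (z * t - x))) := by
        rw [Finset.mul_sum]
        refine Finset.sum_congr rfl fun y _ => ?_
        rw [show y * (2 * (r : ZMod N) * (z * t - x)) = (r : ZMod N) * (1 : ZMod N)⁻¹ *
          (0 * x ^ 2 - 2 * x * y + 0 * y ^ 2) + 2 * (r : ZMod N) * t * y * z by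
            rw [ZMod.inv_one]; ring, e_add]
        ring
    _ = _ := by
        have hh : 2 * (r : ZMod N) * (z * t - x) = 0 ↔ z * t = x := by
          rw [← hw, ← Units.val_mul, Units.mul_right_eq_zero, sub_eq_zero]
        have := sqrt_ne (N := N)
        rw [sum_e]
        simp only [hh]
        split_ifs
        · rw [← sqrt_mul (N := N)]; field_simp
        · simp

lemma bigCell_omegaInv_mul (h2 : IsUnit (2 : ZMod N)) (r : (ZMod N)ˣ) :
    bigCell r omegaMat⁻¹ * bigCell r (omegaMat : SL(2, ZMod N)) = 1 := by
  have e1 : bigCell r (omegaMat : SL(2, ZMod N)) = Matrix.of fun y z =>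
      e (2 * (r : ZMod N) * 1 * y * z) * (gaussS r (-1) / (Real.sqrt N : ℂ)) := by
    ext y z
    simp only [bigCell, Matrix.of_apply, omega_10]
    rw [mul_comm]
    congr 2
    rw [show (-1 : ZMod N)⁻¹ = -1 by
      have := inv_eq (-1 : (ZMod N)ˣ); simp]
    simp [omegaMat]; ring
  have s7 := gaussS_mul_neg h2 r 1
  have := sqrt_ne (N := N)
  simp only [Units.val_one] at s7
  ext x z
  rw [e1, omegaInv_mul_apply r h2, mul_one, Matrix.one_apply]
  simp only [eq_comm (a := z)]
  split_ifs
  · field_simp; rw [s7]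
  · rfl

/-- `ℤ / N` has at most one maximal ideal. -/
def Loc (N : ℕ) : Prop := ∀ a b : ZMod N, IsUnit (a + b) → IsUnit a ∨ IsUnit b

lemma Loc.coprime (hL : Loc N) {a c : ZMod N} (h : IsCoprime a c) : IsUnit a ∨ IsUnit c := by
  obtain ⟨s, t, hst⟩ := h
  rcases hL (s * a) (t * c) (by rw [hst]; exact isUnit_one) with h | h
  · exact Or.inl (isUnit_of_mul_isUnit_right h)
  · exact Or.inr (isUnit_of_mul_isUnit_right h)

lemma Loc.pair (hL : Loc N) {a c : ZMod N} (h : IsCoprime a c) {x y : ZMod N}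
    (hxy : IsUnit (x - y)) : IsUnit (x * c - a) ∨ IsUnit (y * c - a) := by
  by_cases hc : IsUnit c
  · have h1 : IsUnit ((x * c - a) + -(y * c - a)) := by
      convert hxy.mul hc using 1; ring
    simpa only [IsUnit.neg_iff] using hL _ _ h1
  · have ha := (hL.coprime h).resolve_right hc
    have h1 : IsUnit (-(x * c - a) + x * c) := by convert ha using 1; ring
    rcases hL _ _ h1 with h | h
    · exact Or.inl (by simpa only [IsUnit.neg_iff] using h)
    · exact absurd (isUnit_of_mul_isUnit_right h) hc

/-- Any two columns can be moved into the big cell simultaneously. -/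
lemma Loc.generic (hL : Loc N) (h2 : IsUnit (2 : ZMod N)) {a c a' c' : ZMod N}
    (h : IsCoprime a c) (h' : IsCoprime a' c') :
    ∃ x, IsUnit (x * c - a) ∧ IsUnit (x * c' - a') := by
  have d1 : IsUnit ((0 : ZMod N) - 1) := by simp
  have d2 : IsUnit ((1 : ZMod N) - -1) := by convert h2 using 1; norm_num
  have d3 : IsUnit ((0 : ZMod N) - -1) := by simp
  have p1 := hL.pair h d1
  have p2 := hL.pair h d2
  have p3 := hL.pair h d3
  have q1 := hL.pair h' d1
  have q2 := hL.pair h' d2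
  have q3 := hL.pair h' d3
  by_contra hcon
  push Not at hcon
  have c0 := hcon 0
  have c1 := hcon 1
  have c2 := hcon (-1)
  tauto

lemma coprime_col (g : SL(2, ZMod N)) : IsCoprime (g 0 0) (g 1 0) := by
  refine ⟨g 1 1, -g 0 1, ?_⟩
  linear_combination det_eq g

/-- The matrix `(x, -1; 1, 0)`. -/
def wMat (x : ZMod N) : SL(2, ZMod N) := ⟨!![x, -1; 1, 0], by simp [det_fin_two]⟩

lemma wMat_10 (x : ZMod N) : (wMat x) 1 0 = 1 := rfl

lemma wMat_00 (x : ZMod N) : (wMat x) 0 0 = x := rfl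
lemma wMat_11 (x : ZMod N) : (wMat x) 1 1 = 0 := rfl

lemma wMat_inv_mul_10 (x : ZMod N) (g : SL(2, ZMod N)) :
    ((wMat x)⁻¹ * g) 1 0 = x * g 1 0 - g 0 0 := by
  rw [mul_10, inv_10, inv_11, wMat_10, wMat_00]; ring

lemma inv_mul_wMat_10 (x : ZMod N) (g : SL(2, ZMod N)) :
    (g⁻¹ * wMat x) 1 0 = - (x * g 1 0 - g 0 0) := by
  rw [mul_10, inv_10, inv_11, wMat_10, wMat_00]; ring

/-- The two factorisations `g = u (u⁻¹ g) = v (v⁻¹ g)` give the same operator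
if `u⁻¹ v` lies in the big cell. -/
lemma step1 (h2 : IsUnit (2 : ZMod N)) (r : (ZMod N)ˣ) (hr : GaussMul r)
    (g u v : SL(2, ZMod N)) (hu : IsUnit (u 1 0)) (hv : IsUnit (v 1 0))
    (hug : IsUnit ((u⁻¹ * g) 1 0)) (hvg : IsUnit ((v⁻¹ * g) 1 0))
    (huv : IsUnit ((u⁻¹ * v) 1 0)) :
    bigCell r u * bigCell r (u⁻¹ * g) = bigCell r v * bigCell r (v⁻¹ * g) := by
  have e1 := bigCell_mul h2 r hr (u⁻¹ * v) (v⁻¹ * g) huv hvg (by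
    rwa [mul_assoc, mul_inv_cancel_left])
  have e2 := bigCell_mul h2 r hr u (u⁻¹ * v) hu huv (by rwa [mul_inv_cancel_left])
  rw [mul_assoc, mul_inv_cancel_left] at e1
  rw [mul_inv_cancel_left] at e2
  rw [← e1, ← e2, mul_assoc]


lemma weilMatrix_eq (h2 : IsUnit (2 : ZMod N)) (r : (ZMod N)ˣ) (hr : GaussMul r) (hL : Loc N)
    (g u : SL(2, ZMod N)) (hu : IsUnit (u 1 0)) (hug : IsUnit ((u⁻¹ * g) 1 0)) :
    weilMatrix r g = bigCell r u * bigCell r (u⁻¹ * g) := by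
  unfold weilMatrix
  split_ifs with hc
  · rw [bigCell_mul h2 r hr u _ hu hug (by rwa [mul_inv_cancel_left]), mul_inv_cancel_left]
  · have ha := (hL.coprime (coprime_col g)).resolve_right hc
    have hv : IsUnit ((omegaMat : SL(2, ZMod N))⁻¹ 1 0) := by rw [omegaInv_10]; exact isUnit_one
    have hvg : IsUnit (((omegaMat : SL(2, ZMod N))⁻¹⁻¹ * g) 1 0) := by
      rw [inv_inv, omega_mul_10]; exact ha.neg
    have key : bigCell r u * bigCell r (u⁻¹ * g) =
        bigCell r omegaMat⁻¹ * bigCell r ((omegaMat : SL(2, ZMod N))⁻¹⁻¹ * g) := by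
      by_cases huv : IsUnit ((u⁻¹ * (omegaMat : SL(2, ZMod N))⁻¹) 1 0)
      · exact step1 h2 r hr g u _ hu hv hug hvg huv
      · have e1 : (u⁻¹ * (omegaMat : SL(2, ZMod N))⁻¹) 1 0 = u 0 0 := by
          rw [mul_10, inv_10, inv_11, omegaInv_10, omegaInv_00]; ring
        rw [e1] at huv
        obtain ⟨x, hx1, hx2⟩ := hL.generic h2 (coprime_col g) (coprime_col u)
        have hx : IsUnit x := by
          rcases hL (x * u 1 0) (-u 0 0) (by rwa [← sub_eq_add_neg]) with h | h
          · exact isUnit_of_mul_isUnit_left h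
          · rw [IsUnit.neg_iff] at h; exact absurd h huv
        have hw : IsUnit ((wMat x) 1 0) := by rw [wMat_10]; exact isUnit_one
        have hwg : IsUnit (((wMat x)⁻¹ * g) 1 0) := by rwa [wMat_inv_mul_10]
        rw [step1 h2 r hr g u (wMat x) hu hw hug hwg (by rw [inv_mul_wMat_10]; exact hx2.neg),
          step1 h2 r hr g (omegaMat)⁻¹ (wMat x) hv hw hvg hwg (by
            rw [inv_mul_wMat_10, omegaInv_10, omegaInv_00]; simpa using hx)]
    rw [key, inv_inv]

lemma bigCell_mul_weilMatrix (h2 : IsUnit (2 : ZMod N)) (r : (ZMod N)ˣ) (hr : GaussMul r)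
    (hL : Loc N) (u h : SL(2, ZMod N)) (hu : IsUnit (u 1 0)) :
    bigCell r u * weilMatrix r h = weilMatrix r (u * h) := by
  obtain ⟨x, hx1, hx2⟩ := hL.generic h2 (coprime_col h) (coprime_col u⁻¹)
  have hw : IsUnit ((wMat x) 1 0) := by rw [wMat_10]; exact isUnit_one
  have hwh : IsUnit (((wMat x)⁻¹ * h) 1 0) := by rwa [wMat_inv_mul_10]
  have huw : IsUnit ((u * wMat x) 1 0) := by
    rw [← inv_inv u, inv_mul_wMat_10]; exact hx2.neg
  have hc : (u * wMat x)⁻¹ * (u * h) = (wMat x)⁻¹ * h := by group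
  rw [weilMatrix_eq h2 r hr hL h _ hw hwh, ← mul_assoc, bigCell_mul h2 r hr _ _ hu hw huw,
    weilMatrix_eq h2 r hr hL (u * h) _ huw (by rwa [hc]), hc]

lemma weilMatrix_mul (h2 : IsUnit (2 : ZMod N)) (r : (ZMod N)ˣ) (hr : GaussMul r)
    (hL : Loc N) (g h : SL(2, ZMod N)) :
    weilMatrix r (g * h) = weilMatrix r g * weilMatrix r h := by
  obtain ⟨x, hx1, -⟩ := hL.generic h2 (coprime_col g) (coprime_col g)
  have hw : IsUnit ((wMat x) 1 0) := by rw [wMat_10]; exact isUnit_one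
  have hwg : IsUnit (((wMat x)⁻¹ * g) 1 0) := by rwa [wMat_inv_mul_10]
  rw [weilMatrix_eq h2 r hr hL g _ hw hwg, mul_assoc, bigCell_mul_weilMatrix h2 r hr hL _ _ hwg,
    bigCell_mul_weilMatrix h2 r hr hL _ _ hw]
  congr 1; group

lemma weilMatrix_one (h2 : IsUnit (2 : ZMod N)) (r : (ZMod N)ˣ) (hr : GaussMul r)
    (hL : Loc N) : weilMatrix r (1 : SL(2, ZMod N)) = 1 := by
  have := weilMatrix_eq h2 r hr hL 1 omegaMat⁻¹ (by rw [omegaInv_10]; exact isUnit_one)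
    (by rw [inv_inv, mul_one, omega_10]; exact isUnit_one.neg)
  rw [this, inv_inv, mul_one, bigCell_omegaInv_mul h2]

/-- Diagonalising `u x² + v y²` as `x² + u v y²` when it represents `1`. -/
lemma gaussMul_of_rep (r : (ZMod N)ˣ)
    (h : ∀ u v : (ZMod N)ˣ, ∃ s t : ZMod N, u * s ^ 2 + v * t ^ 2 = 1) : GaussMul r := by
  intro u v
  obtain ⟨s, t, hst⟩ := h u v
  unfold gaussS
  rw [mul_mul_mul_comm, mul_mul_mul_comm (1 / (Real.sqrt N : ℂ)) (∑ y : ZMod N, _),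
    Finset.sum_mul_sum, Finset.sum_mul_sum,
    ← Finset.sum_product', ← Finset.sum_product']
  congr 1
  symm
  let E : ZMod N × ZMod N ≃ ZMod N × ZMod N :=
    { toFun := fun q => (s * q.1 - v * t * q.2, t * q.1 + u * s * q.2)
      invFun := fun q => (u * s * q.1 + v * t * q.2, -t * q.1 + s * q.2)
      left_inv := fun q => by
        ext
        · linear_combination q.1 * hst
        · linear_combination q.2 * hst
      right_inv := fun q => by
        ext
        · linear_combination q.1 * hst
        · linear_combination q.2 * hst }
  refine Fintype.sum_equiv E _ _ fun q => ?_
  simp only [E, Equiv.coe_fn_mk, ← e_add]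
  congr 1
  push_cast
  linear_combination (r : ZMod N) * (q.1 ^ 2 + u * v * q.2 ^ 2) * hst

end general

section primePower
variable {p : ℕ} [Fact p.Prime] {k : ℕ}

lemma isUnit_iff (hk : k ≠ 0) (x : ZMod (p ^ k)) :
    IsUnit x ↔ ZMod.castHom (dvd_pow_self p hk) (ZMod p) x ≠ 0 := by
  have hp : p.Prime := Fact.out
  obtain ⟨n, rfl⟩ := ZMod.natCast_zmod_surjective x
  rw [ZMod.isUnit_iff_coprime, map_natCast, Ne, ZMod.natCast_eq_zero_iff,
    Nat.coprime_pow_right_iff (Nat.pos_of_ne_zero hk), Nat.coprime_comm, hp.coprime_iff_not_dvd]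

lemma loc_primePow : Loc (p ^ k) := by
  intro a b h
  rcases eq_or_ne k 0 with rfl | hk
  · left
    have : Subsingleton (ZMod (p ^ 0)) := by rw [pow_zero]; infer_instance
    rw [Subsingleton.elim a 1]; exact isUnit_one
  · rw [isUnit_iff hk] at *
    rw [isUnit_iff hk]
    rw [map_add] at h
    by_contra hc
    push Not at hc
    exact h (by rw [hc.1, hc.2, add_zero])

lemma isUnit_two (hp : p ≠ 2) : IsUnit (2 : ZMod (p ^ k)) := by
  have hpp : p.Prime := Fact.out
  have := (ZMod.isUnit_iff_coprime 2 (p ^ k)).mpr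
    (((Nat.coprime_primes Nat.prime_two hpp).mpr hp.symm).pow_right k)
  exact_mod_cast this

open Polynomial in
lemma rep_primePow (hp : p ≠ 2) (u v : (ZMod (p ^ k))ˣ) :
    ∃ s t : ZMod (p ^ k), u * s ^ 2 + v * t ^ 2 = 1 := by
  have hpp : p.Prime := Fact.out
  rcases eq_or_ne k 0 with rfl | hk
  · have : Subsingleton (ZMod (p ^ 0)) := by rw [pow_zero]; infer_instance
    exact ⟨0, 0, Subsingleton.elim _ _⟩
  set φ := ZMod.castHom (dvd_pow_self p hk) (ZMod p) with hφ
  have hu := (isUnit_iff hk _).mp u.isUnit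
  have hv := (isUnit_iff hk _).mp v.isUnit
  rw [← hφ] at hu hv
  have hex : ∃ a b : ZMod p, φ u * a ^ 2 + φ v * b ^ 2 = 1 := by
    have d1 : (C (φ u) * X ^ 2 + C 0 * X + C (-1) : Polynomial (ZMod p)).degree = 2 :=
      degree_quadratic hu
    have d2 : (C (φ v) * X ^ 2 + C 0 * X + C 0 : Polynomial (ZMod p)).degree = 2 :=
      degree_quadratic hv
    obtain ⟨a, b, hab⟩ := FiniteField.exists_root_sum_quadratic d1 d2 (by
      rw [ZMod.card]; exact hpp.eq_two_or_odd.resolve_left hp)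
    refine ⟨a, b, ?_⟩
    simp at hab
    linear_combination hab
  obtain ⟨a, b, hab⟩ := hex
  obtain ⟨s, rfl⟩ := ZMod.castHom_surjective (dvd_pow_self p hk) a
  obtain ⟨t, rfl⟩ := ZMod.castHom_surjective (dvd_pow_self p hk) b
  rw [← hφ] at hab
  set l := (u : ZMod (p ^ k)) * s ^ 2 + v * t ^ 2 with hl
  have hφl : φ l = 1 := by rw [hl]; simpa using hab
  -- `l ≡ 1 mod p`, hence `l ^ (p ^ (k - 1)) = 1` and `l` is a square
  have hdiv : (p : ZMod (p ^ k)) ∣ l - 1 := by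
    obtain ⟨n, hn⟩ := ZMod.natCast_zmod_surjective (l - 1)
    have : φ (n : ZMod (p ^ k)) = 0 := by rw [hn, map_sub, hφl, map_one, sub_self]
    rw [map_natCast, ZMod.natCast_eq_zero_iff] at this
    rw [← hn]
    exact_mod_cast Nat.cast_dvd_cast (α := ZMod (p ^ k)) this
  have hpow : l ^ p ^ (k - 1) = 1 := by
    have := dvd_sub_pow_of_dvd_sub hdiv (k - 1)
    rw [Nat.sub_add_cancel (Nat.one_le_iff_ne_zero.mpr hk), one_pow, ← Nat.cast_pow,
      ZMod.natCast_self, zero_dvd_iff, sub_eq_zero] at this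
    exact this
  obtain ⟨m, hm⟩ : Odd (p ^ (k - 1)) := (hpp.odd_of_ne_two hp).pow
  refine ⟨s * l ^ m, t * l ^ m, ?_⟩
  have : (u : ZMod (p ^ k)) * (s * l ^ m) ^ 2 + v * (t * l ^ m) ^ 2 = l * l ^ (2 * m) := by
    rw [hl]; ring
  rw [this, ← pow_succ', ← hm, hpow]

lemma gaussMul_primePow (hp : p ≠ 2) (r : (ZMod (p ^ k))ˣ) : GaussMul r :=
  gaussMul_of_rep r (rep_primePow hp)

end primePower

/-- The Weil representation `U_{p^k}` of `SL(2, ℤ / p^k)` on `L²(ℤ / p^k)`, `p` an odd prime,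
with parameter the unit `r`. -/
def weilRep {p k : ℕ} [Fact p.Prime] (hp : p ≠ 2) (r : (ZMod (p ^ k))ˣ) :
    Representation ℂ SL(2, ZMod (p ^ k)) (ZMod (p ^ k) → ℂ) where
  toFun g := Matrix.toLin' (weilMatrix r g)
  map_one' := by
    rw [weilMatrix_one (isUnit_two hp) r (gaussMul_primePow hp r) loc_primePow,
      Matrix.toLin'_one]; rfl
  map_mul' g h := by
    rw [weilMatrix_mul (isUnit_two hp) r (gaussMul_primePow hp r) loc_primePow,
      Matrix.toLin'_mul]; rfl

/-- The factor `Λ(t)` of the Weil representation. -/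
def weilLambda {N : ℕ} [NeZero N] (r t : (ZMod N)ˣ) : ℂ :=
  gaussS r (-(t : ZMod N)) / gaussS r (-1)

/-! The three formulas by which the Weil representation is given on the generators. -/

section formulas
variable {p k : ℕ} [Fact p.Prime]

lemma weilRep_apply (hp : p ≠ 2) (r : (ZMod (p ^ k))ˣ) (g : SL(2, ZMod (p ^ k)))
    (ψ : ZMod (p ^ k) → ℂ) (x : ZMod (p ^ k)) :
    weilRep hp r g ψ x = ∑ y, weilMatrix r g x y * ψ y := rfl

lemma weilRep_omegaMat (hp : p ≠ 2) (r : (ZMod (p ^ k))ˣ)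
    (ψ : ZMod (p ^ k) → ℂ) (x : ZMod (p ^ k)) :
    weilRep hp r omegaMat ψ x =
      gaussS r (-1) / (Real.sqrt (p ^ k : ℕ) : ℂ) *
        ∑ y, ψ y * e (2 * (r : ZMod (p ^ k)) * x * y) := by
  rw [weilRep_apply, Finset.mul_sum]
  refine Finset.sum_congr rfl fun y _ => ?_
  rw [weilMatrix, if_pos (by rw [omega_10]; exact isUnit_one.neg)]
  simp only [bigCell, Matrix.of_apply, omega_10, omega_00, omega_11]
  rw [show (-1 : ZMod (p ^ k))⁻¹ = -1 by
    have := inv_eq (-1 : (ZMod (p ^ k))ˣ); simp]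
  rw [show (r : ZMod (p ^ k)) * -1 * (0 * x ^ 2 - 2 * x * y + 0 * y ^ 2)
    = 2 * (r : ZMod (p ^ k)) * x * y by ring]
  ring

lemma weilMatrix_nonOmega (hp : p ≠ 2) (r : (ZMod (p ^ k))ˣ) (g : SL(2, ZMod (p ^ k)))
    (hg : IsUnit (g 0 0)) :
    weilMatrix r g = bigCell r omegaMat⁻¹ * bigCell r (omegaMat * g) := by
  have := weilMatrix_eq (isUnit_two hp) r (gaussMul_primePow hp r) loc_primePow g omegaMat⁻¹
    (by rw [omegaInv_10]; exact isUnit_one) (by rw [inv_inv, omega_mul_10]; exact hg.neg)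
  rwa [inv_inv] at this

lemma omega_mul_00 {N : ℕ} [NeZero N] (g : SL(2, ZMod N)) :
    ((omegaMat * g : SL(2, ZMod N)) 0 0) = g 1 0 := by
  rw [Matrix.SpecialLinearGroup.coe_mul, Matrix.mul_apply, Fin.sum_univ_two, omega_00,
    show (omegaMat : SL(2, ZMod N)) 0 1 = 1 from rfl]
  ring

lemma omega_mul_11 {N : ℕ} [NeZero N] (g : SL(2, ZMod N)) :
    ((omegaMat * g : SL(2, ZMod N)) 1 1) = -g 0 1 := by
  rw [Matrix.SpecialLinearGroup.coe_mul, Matrix.mul_apply, Fin.sum_univ_two, omega_10, omega_11]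
  ring

lemma weilRep_nMat (hp : p ≠ 2) (r : (ZMod (p ^ k))ˣ) (b : ZMod (p ^ k))
    (ψ : ZMod (p ^ k) → ℂ) (x : ZMod (p ^ k)) :
    weilRep hp r (nMat b) ψ x = e ((r : ZMod (p ^ k)) * b * x ^ 2) * ψ x := by
  have e1 : bigCell r (omegaMat * nMat b) = Matrix.of fun y z =>
      e (2 * (r : ZMod (p ^ k)) * 1 * y * z) *
        (gaussS r (-1) / (Real.sqrt (p ^ k : ℕ) : ℂ) * e ((r : ZMod (p ^ k)) * b * z ^ 2)) := by
    ext y z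
    simp only [bigCell, Matrix.of_apply, omega_mul_10, omega_mul_00, omega_mul_11]
    rw [show (nMat b : SL(2, ZMod (p ^ k))) 0 0 = 1 from rfl,
      show (nMat b : SL(2, ZMod (p ^ k))) 1 0 = 0 from rfl,
      show (nMat b : SL(2, ZMod (p ^ k))) 0 1 = b from rfl,
      show (-1 : ZMod (p ^ k))⁻¹ = -1 by
        have := inv_eq (-1 : (ZMod (p ^ k))ˣ); simp]
    rw [mul_left_comm, ← e_add]
    congr 2
    ring
  have s7 := gaussS_mul_neg (isUnit_two hp) r 1
  have := sqrt_ne (N := p ^ k)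
  simp only [Units.val_one] at s7
  rw [weilRep_apply, weilMatrix_nonOmega hp r _ isUnit_one, e1, Finset.sum_eq_single x]
  · rw [omegaInv_mul_apply r (isUnit_two hp), mul_one, if_pos rfl]
    field_simp
    rw [s7, one_mul]
  · intro y _ hy
    rw [omegaInv_mul_apply r (isUnit_two hp), mul_one, if_neg hy, zero_mul]
  · simp

lemma weilRep_aMat (hp : p ≠ 2) (r t : (ZMod (p ^ k))ˣ)
    (ψ : ZMod (p ^ k) → ℂ) (x : ZMod (p ^ k)) :
    weilRep hp r (aMat t) ψ x = weilLambda r t * ψ (t * x) := by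
  have e1 : bigCell r (omegaMat * aMat t) = Matrix.of fun y z =>
      e (2 * (r : ZMod (p ^ k)) * ((t⁻¹ : (ZMod (p ^ k))ˣ) : ZMod (p ^ k)) * y * z) *
        (gaussS r (-(t : ZMod (p ^ k))) / (Real.sqrt (p ^ k : ℕ) : ℂ)) := by
    ext y z
    simp only [bigCell, Matrix.of_apply, omega_mul_10, omega_mul_00, omega_mul_11]
    rw [show (aMat t : SL(2, ZMod (p ^ k))) 0 0 = t from rfl,
      show (aMat t : SL(2, ZMod (p ^ k))) 1 0 = 0 from rfl,
      show (aMat t : SL(2, ZMod (p ^ k))) 0 1 = 0 from rfl,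
      ← Units.val_neg, inv_eq, inv_neg, mul_comm]
    congr 2
    push_cast
    ring
  have s7 := gaussS_mul_neg (isUnit_two hp) r 1
  have := sqrt_ne (N := p ^ k)
  simp only [Units.val_one] at s7
  have hx : ∀ y : ZMod (p ^ k), y * ((t⁻¹ : (ZMod (p ^ k))ˣ) : ZMod (p ^ k)) = x ↔ y = t * x := by
    intro y
    rw [Units.mul_inv_eq_iff_eq_mul, mul_comm]
  rw [weilRep_apply, weilMatrix_nonOmega hp r _ t.isUnit, e1, Finset.sum_eq_single (t * x)]
  · rw [omegaInv_mul_apply r (isUnit_two hp), if_pos ((hx _).mpr rfl), weilLambda,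
      div_eq_mul_inv (gaussS r (-(t : ZMod (p ^ k)))) (gaussS r (-1)),
      ← eq_inv_of_mul_eq_one_left s7]
    field_simp
  · intro y _ hy
    rw [omegaInv_mul_apply r (isUnit_two hp), if_neg (fun h => hy ((hx y).mp h)), zero_mul]
  · simp

end formulas

/-- The matrices defining quantizable cat maps for odd `N`: `|tr A| > 2`, odd diagonal entries
and even off-diagonal entries. -/
structure IsCatMap (A : SL(2, ℤ)) : Prop where
  hyperbolic : 2 < |A 0 0 + A 1 1|
  odd_00 : Odd (A 0 0)
  odd_11 : Odd (A 1 1)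
  even_01 : Even (A 0 1)
  even_10 : Even (A 1 0)

/-- The matrices `g = x I + y A` of determinant `1` over `ℤ / N`. -/
def heckeSet (N : ℕ) (A : SL(2, ℤ)) : Set SL(2, ZMod N) :=
  {g | ∃ x y : ZMod N, (g : Matrix (Fin 2) (Fin 2) (ZMod N)) =
    x • (1 : Matrix (Fin 2) (Fin 2) (ZMod N)) +
      y • (A : Matrix (Fin 2) (Fin 2) ℤ).map (fun n : ℤ => (n : ZMod N))}

/-- A Hecke eigenfunction: a joint eigenfunction of all Hecke operators `U_N(g)`,
`g = x I + y A` with `det g = 1`, where `N = p ^ k`. -/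
structure IsHeckeEigenfunction {p k : ℕ} [Fact p.Prime] (hp : p ≠ 2) (r : (ZMod (p ^ k))ˣ)
    (A : SL(2, ℤ)) (ψ : ZMod (p ^ k) → ℂ) : Prop where
  ne_zero : ψ ≠ 0
  eigen : ∀ g ∈ heckeSet (p ^ k) A, ∃ c : ℂ, weilRep hp r g ψ = c • ψ

/-- The norm of `L²(ℤ / N)`, with normalised counting measure. -/
def l2Norm {N : ℕ} [NeZero N] (ψ : ZMod N → ℂ) : ℝ :=
  Real.sqrt ((1 / (N : ℝ)) * ∑ x : ZMod N, ‖ψ x‖ ^ 2)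

/-- The supremum norm on functions on `ℤ / N`. -/
def supNorm {N : ℕ} (ψ : ZMod N → ℂ) : ℝ := ⨆ x : ZMod N, ‖ψ x‖

end
end CatMap

namespace CatMap

/-! Put m = [k/2] and P = p^(k-m), so that P² = 0 in ℤ/p^k. The lattice P(ℤ/p^k)² is isotropic and
stable under SL(2), so the vectors fixed by its Heisenberg operators should form a subspace stable
under the whole Weil representation. Concretely, this subspace `latticeFixed P` consists of the
P-periodic functions supported where xP = 0, that is, on the multiples of p^m. Its invariance is
checked directly on the kernels: `bigCell_mulVec_mem` treats one big cell kernel, and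
`weilRep_mem_latticeFixed` extends this to every g.

The Hecke operators commute, because the matrices xI + yA do, and they preserve this nonzero
subspace. Hence `exists_joint_eigenvector` yields a Hecke eigenfunction inside it. Such a function
lives on at most p^(k-m) points (`card_annihilator_pow_le`), while its normalisation says that the
squares |ψ(x)|² sum to p^k. Some value therefore satisfies |ψ(x)|² ≥ p^m. -/

/-! ### Simultaneous eigenvectors in an invariant subspace. -/

/-- A family of commuting endomorphisms preserving a nonzero finite-dimensional complex subspace
has a joint eigenvector in it. -/
lemma exists_joint_eigenvector {E : Type*} [AddCommGroup E] [Module ℂ E] [FiniteDimensional ℂ E]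
    (S : Set (Module.End ℂ E)) (hS : ∀ f ∈ S, ∀ g ∈ S, Commute f g) (W : Submodule ℂ E)
    (hW : W ≠ ⊥) (hinv : ∀ f ∈ S, ∀ v ∈ W, f v ∈ W) :
    ∃ v ∈ W, v ≠ 0 ∧ ∀ f ∈ S, ∃ c : ℂ, f v = c • v := by
  induction hn : Module.finrank ℂ W using Nat.strong_induction_on generalizing W with
  | _ n ih =>
    subst hn
    -- If all of `S` acts on `W` by scalars, any nonzero vector works. Otherwise a non-scalar `f`
    -- has an eigenspace in `W` that is nonzero, proper, and stable under `S` by commutativity, so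
    -- the induction descends to it.
    by_cases hsc : ∀ f ∈ S, ∃ c : ℂ, ∀ v ∈ W, f v = c • v
    · obtain ⟨v, hv, hv0⟩ := Submodule.exists_mem_ne_zero_of_ne_bot hW
      exact ⟨v, hv, hv0, fun f hf => (hsc f hf).imp fun c hc => hc v hv⟩
    · push Not at hsc
      obtain ⟨f, hf, hfc⟩ := hsc
      have : Nontrivial W := (Submodule.nontrivial_iff_ne_bot).mpr hW
      obtain ⟨c, hc⟩ := Module.End.exists_eigenvalue (f.restrict (hinv f hf))
      obtain ⟨w, hw⟩ := hc.exists_hasEigenvector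
      have hw1 : f w = c • (w : E) := congrArg Subtype.val hw.apply_eq_smul
      have hlt : W ⊓ Module.End.eigenspace f c < W := by
        refine lt_of_le_of_ne inf_le_left fun h => ?_
        obtain ⟨v, hv, hvc⟩ := hfc c
        exact hvc (Module.End.mem_eigenspace_iff.mp (h.ge hv).2)
      obtain ⟨v, hv, h⟩ := ih _ (Submodule.finrank_lt_finrank_of_lt hlt)
        (W ⊓ Module.End.eigenspace f c)
        (fun h => hw.2 (Subtype.ext ((Submodule.eq_bot_iff _).mp h w
          ⟨w.2, Module.End.mem_eigenspace_iff.mpr hw1⟩)))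
        (fun g hg v hv => ⟨hinv g hg v hv.1, Module.End.mem_eigenspace_iff.mpr (by
          have hcom : f (g v) = g (f v) := congrArg (· v) (hS f hf g hg).eq
          rw [hcom, Module.End.mem_eigenspace_iff.mp hv.2, map_smul])⟩) rfl
      exact ⟨v, hv.1, h⟩

/-! ### The subspace attached to an isotropic lattice, and commuting Hecke matrices. -/

section Lattice
variable {N : ℕ}

/-- The `P`-periodic functions supported on the annihilator of `P`. For `P ^ 2 = 0` these are the
functions fixed by the Heisenberg operators attached to the isotropic lattice `P (ℤ / N)²`. -/
def latticeFixed (P : ZMod N) : Submodule ℂ (ZMod N → ℂ) where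
  carrier := {ψ | (∀ x, ψ x ≠ 0 → x * P = 0) ∧ ∀ x, ψ (x + P) = ψ x}
  add_mem' {φ ψ} hφ hψ := ⟨fun x hx => by
      by_cases h : φ x = 0
      · exact hψ.1 x fun h' => hx (by simp [h, h'])
      · exact hφ.1 x h,
    fun x => by simp [hφ.2 x, hψ.2 x]⟩
  zero_mem' := by simp
  smul_mem' c ψ hψ := ⟨fun x hx => hψ.1 x (right_ne_zero_of_mul hx), fun x => by simp [hψ.2 x]⟩

/-- The indicator function of the annihilator of `P` is a witness: `hP` puts `P` itself in the
annihilator, which makes the indicator P-periodic. -/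
lemma latticeFixed_ne_bot {P : ZMod N} (hP : P * P = 0) : latticeFixed P ≠ ⊥ := by
  classical
  refine (Submodule.ne_bot_iff _).mpr ⟨fun x => if x * P = 0 then 1 else 0, ⟨?_, ?_⟩, fun h => ?_⟩
  · intro x hx
    by_contra h
    exact hx (if_neg h)
  · intro x
    simp [add_mul, hP]
  · simpa using congrFun h 0

/-- Both matrices are polynomials in the same reduction of `A`. -/
lemma heckeSet_commute (A : SL(2, ℤ)) {g h : SL(2, ZMod N)} (hg : g ∈ heckeSet N A)
    (hh : h ∈ heckeSet N A) : Commute g h := by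
  obtain ⟨x, y, hg⟩ := hg
  obtain ⟨x', y', hh⟩ := hh
  refine Subtype.ext ?_
  rw [Matrix.SpecialLinearGroup.coe_mul, Matrix.SpecialLinearGroup.coe_mul, hg, hh]
  generalize (A : Matrix (Fin 2) (Fin 2) ℤ).map (fun n : ℤ => (n : ZMod N)) = B
  simp only [add_mul, mul_add, smul_mul_smul_comm, one_mul, mul_one, mul_comm x', mul_comm y']
  abel

/-! ### Invariance under the big cell kernels. -/

variable [NeZero N]

lemma e_eq_one_iff (x : ZMod N) : e x = 1 ↔ x = 0 := by
  rw [← e_zero (N := N)]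
  exact ZMod.injective_stdAddChar.eq_iff

/-- The kernel is a quadratic phase in x and y. Periodicity of ψ in y forces the support condition
on the image, and the support condition on ψ forces periodicity of the image in x: the two defining
conditions are exchanged, as under a Fourier transform. -/
lemma bigCell_mulVec_mem (h2 : IsUnit (2 : ZMod N)) (r : (ZMod N)ˣ) (g : SL(2, ZMod N))
    (hg : IsUnit (g 1 0)) {P : ZMod N} (hP : P * P = 0) {ψ : ZMod N → ℂ}
    (hψ : ψ ∈ latticeFixed P) : bigCell r g *ᵥ ψ ∈ latticeFixed P := by
  obtain ⟨c, hc⟩ := hg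
  obtain ⟨w, hw⟩ := h2
  have happ (x : ZMod N) : (bigCell r g *ᵥ ψ) x = ∑ y, bigCell r g x y * ψ y := rfl
  have hsupp : ∀ x, (bigCell r g *ᵥ ψ) x ≠ 0 → x * P = 0 := by
    intro x hx
    -- Substitute y + P for y in the sum. On the support of ψ the terms in yP and P² vanish, so only
    -- the cross term -2xP contributes, and its phase does not depend on y.
    have hshift : (bigCell r g *ᵥ ψ) x =
        e (-(2 * (r : ZMod N) * (g 1 0)⁻¹ * (x * P))) * (bigCell r g *ᵥ ψ) x := by
      conv_lhs => rw [happ, ← Equiv.sum_comp (Equiv.addRight P)]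
      rw [happ, Finset.mul_sum]
      refine Finset.sum_congr rfl fun y _ => ?_
      rw [Equiv.coe_addRight, hψ.2 y]
      by_cases hy : ψ y = 0
      · simp [hy]
      have hyP := hψ.1 y hy
      simp only [bigCell, Matrix.of_apply]
      have he : e ((r : ZMod N) * (g 1 0)⁻¹ *
          (g 0 0 * x ^ 2 - 2 * x * (y + P) + g 1 1 * (y + P) ^ 2)) =
          e (-(2 * (r : ZMod N) * (g 1 0)⁻¹ * (x * P))) *
            e ((r : ZMod N) * (g 1 0)⁻¹ * (g 0 0 * x ^ 2 - 2 * x * y + g 1 1 * y ^ 2)) := by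
        rw [← e_add]
        congr 1
        linear_combination (2 * (r : ZMod N) * (g 1 0)⁻¹ * g 1 1) * hyP +
          ((r : ZMod N) * (g 1 0)⁻¹ * g 1 1) * hP
      rw [he]
      ring
    -- A nonzero value equal to itself times a phase forces the phase to be 1; the unit factor 2rc⁻¹
    -- then cancels, leaving xP = 0.
    have h1 := (e_eq_one_iff _).mp (mul_eq_right₀ hx |>.mp hshift.symm)
    rw [neg_eq_zero, ← hc, inv_eq, ← hw, ← Units.val_mul, ← Units.val_mul,
      Units.mul_right_eq_zero] at h1
    exact h1
  refine ⟨hsupp, fun x => ?_⟩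
  -- On the annihilator, the kernel rows at x and x + P agree on the support of ψ. Off it, x + P is
  -- also off it because P² = 0, so both values are 0.
  by_cases hx : x * P = 0
  · rw [happ, happ]
    refine Finset.sum_congr rfl fun y _ => ?_
    by_cases hy : ψ y = 0
    · simp [hy]
    have hyP := hψ.1 y hy
    simp only [bigCell, Matrix.of_apply]
    congr 3
    linear_combination ((r : ZMod N) * (g 1 0)⁻¹) * (2 * g 0 0 * hx + g 0 0 * hP - 2 * hyP)
  · rw [not_imp_comm.mp (hsupp x) hx,
      not_imp_comm.mp (hsupp (x + P)) (by rwa [add_mul, hP, add_zero])]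

/-! ### Norms and the size of the support. -/

lemma l2Norm_smul (c : ℂ) (ψ : ZMod N → ℂ) : l2Norm (c • ψ) = ‖c‖ * l2Norm ψ := by
  simp only [l2Norm, Pi.smul_apply, smul_eq_mul, norm_mul, mul_pow, ← Finset.mul_sum]
  rw [mul_left_comm, Real.sqrt_mul (by positivity), Real.sqrt_sq (norm_nonneg c)]

lemma l2Norm_pos {ψ : ZMod N → ℂ} (hψ : ψ ≠ 0) : 0 < l2Norm ψ := by
  obtain ⟨x, hx⟩ := Function.ne_iff.mp hψ
  have : (0 : ℝ) < N := by exact_mod_cast Nat.pos_of_ne_zero (NeZero.ne N)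
  refine Real.sqrt_pos.mpr (mul_pos (by positivity) ?_)
  exact Finset.sum_pos' (fun _ _ => by positivity) ⟨x, Finset.mem_univ x, by
    have := norm_pos_iff.mpr hx; positivity⟩

/-- A function of small support has large supremum norm. -/
lemma card_le_card_support_mul_supNorm_sq {ψ : ZMod N → ℂ} (hψ : l2Norm ψ = 1)
    (s : Finset (ZMod N)) (hs : ∀ x, ψ x ≠ 0 → x ∈ s) : (N : ℝ) ≤ s.card * supNorm ψ ^ 2 := by
  have hN : (0 : ℝ) < N := by exact_mod_cast Nat.pos_of_ne_zero (NeZero.ne N)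
  -- With normalised counting measure, norm one means that the squares ‖ψ x‖² sum to `N`, not to 1.
  rw [l2Norm, Real.sqrt_eq_one, one_div, inv_mul_eq_one₀ hN.ne'] at hψ
  rw [hψ, ← Finset.sum_subset (Finset.subset_univ s) fun x _ hx => by
    rw [not_imp_comm.mp (hs x) hx]; simp, ← nsmul_eq_mul]
  refine Finset.sum_le_card_nsmul _ _ _ fun x _ => ?_
  have : ‖ψ x‖ ≤ supNorm ψ := le_ciSup (f := fun x => ‖ψ x‖) (Set.finite_range _).bddAbove x
  gcongr

end Lattice

/-! ### Prime powers: full invariance, counting, and the localised eigenfunction. -/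

section PrimePower
variable {p k : ℕ} [Fact p.Prime]

lemma weilRep_mem_latticeFixed (hp : p ≠ 2) (r : (ZMod (p ^ k))ˣ) (g : SL(2, ZMod (p ^ k)))
    {P : ZMod (p ^ k)} (hP : P * P = 0) {ψ : ZMod (p ^ k) → ℂ} (hψ : ψ ∈ latticeFixed P) :
    weilRep hp r g ψ ∈ latticeFixed P := by
  change weilMatrix r g *ᵥ ψ ∈ _
  have h2 := isUnit_two (k := k) hp
  rw [weilMatrix]
  split_ifs with hg
  · exact bigCell_mulVec_mem h2 r g hg hP hψ
  -- Here the operator is a product of two big cell kernels. The second has lower left entry -a, a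
  -- unit because a and c are coprime in a local ring and c is not a unit.
  · rw [← Matrix.mulVec_mulVec]
    refine bigCell_mulVec_mem h2 r _ (by rw [omegaInv_10]; exact isUnit_one) hP
      (bigCell_mulVec_mem h2 r _ ?_ hP hψ)
    have hco : IsCoprime (g 0 0) (g 1 0) := ⟨g 1 1, -g 0 1, by linear_combination det_eq g⟩
    rw [omega_mul_10]
    exact (((loc_primePow).coprime hco).resolve_right hg).neg

/-- An annihilated residue has representative divisible by p^m, so dividing its representative by
p^m embeds the annihilator in the integers below p^(k-m). -/
lemma card_annihilator_pow_le {m : ℕ} (hm : m ≤ k) :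
    (Finset.univ.filter fun x : ZMod (p ^ k) => x * (p : ZMod (p ^ k)) ^ (k - m) = 0).card
      ≤ p ^ (k - m) := by
  have hp : 0 < p := (Fact.out : p.Prime).pos
  have hdvd : ∀ x : ZMod (p ^ k), x * (p : ZMod (p ^ k)) ^ (k - m) = 0 → p ^ m ∣ x.val := by
    intro x hx
    rw [← ZMod.natCast_zmod_val x, ← Nat.cast_pow, ← Nat.cast_mul, ZMod.natCast_eq_zero_iff] at hx
    refine Nat.dvd_of_mul_dvd_mul_right (pow_pos hp (k - m)) ?_
    rwa [← pow_add, Nat.add_sub_cancel' hm]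
  rw [← Finset.card_range (p ^ (k - m))]
  refine Finset.card_le_card_of_injOn (fun x => x.val / p ^ m) ?_ ?_
  · intro x _
    simp only [Finset.coe_range, Set.mem_Iio]
    refine Nat.div_lt_of_lt_mul ?_
    rw [← pow_add, Nat.add_sub_cancel' hm]
    exact ZMod.val_lt x
  · intro x hx y hy hxy
    simp only [Finset.coe_filter, Finset.mem_univ, true_and, Set.mem_ofPred_eq] at hx hy
    exact ZMod.val_injective _ (Nat.div_left_inj (hdvd x hx) (hdvd y hy) |>.mp hxy)

/-- Some `L²`-normalised Hecke eigenfunction is supported on the multiples of `p ^ m`,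
for every `m ≤ k / 2`. -/
lemma exists_heckeEigenfunction_supported (hp : p ≠ 2) (r : (ZMod (p ^ k))ˣ) (A : SL(2, ℤ))
    {m : ℕ} (hm : 2 * m ≤ k) :
    ∃ ψ : ZMod (p ^ k) → ℂ, IsHeckeEigenfunction hp r A ψ ∧ l2Norm ψ = 1 ∧
      ∀ x, ψ x ≠ 0 → x * (p : ZMod (p ^ k)) ^ (k - m) = 0 := by
  have hP : (p : ZMod (p ^ k)) ^ (k - m) * (p : ZMod (p ^ k)) ^ (k - m) = 0 := by
    rw [← pow_add, ← Nat.cast_pow, ZMod.natCast_eq_zero_iff]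
    -- This is where m ≤ k/2 matters: it gives 2(k - m) ≥ k.
    exact pow_dvd_pow p (by omega)
  obtain ⟨φ, hφ, hφ0, hφe⟩ := exists_joint_eigenvector (weilRep hp r '' heckeSet (p ^ k) A)
    (by
      rintro _ ⟨g, hg, rfl⟩ _ ⟨h, hh, rfl⟩
      exact (heckeSet_commute A hg hh).map (weilRep hp r))
    _ (latticeFixed_ne_bot hP)
    (by
      rintro _ ⟨g, -, rfl⟩ v hv
      exact weilRep_mem_latticeFixed hp r g hP hv)
  have hpos := l2Norm_pos hφ0
  have hc : ((l2Norm φ)⁻¹ : ℂ) ≠ 0 := inv_ne_zero (by exact_mod_cast hpos.ne')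
  refine ⟨((l2Norm φ)⁻¹ : ℂ) • φ, ⟨smul_ne_zero hc hφ0, fun g hg => ?_⟩, ?_,
    (Submodule.smul_mem _ _ hφ).1⟩
  · obtain ⟨c, hc⟩ := hφe _ ⟨g, hg, rfl⟩
    exact ⟨c, by rw [map_smul, hc, smul_comm]⟩
  · rw [l2Norm_smul, norm_inv, Complex.norm_real, Real.norm_of_nonneg hpos.le,
      inv_mul_cancel₀ hpos.ne']

end PrimePower
end CatMap

/-! ### The lower bound for the supremum norm. -/

theorem mainTheorem5 (p k : ℕ) [Fact p.Prime] (hp : p ≠ 2) (r : (ZMod (p ^ k))ˣ)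
    (A : SL(2, ℤ)) (hA : CatMap.IsCatMap A) :
    ∃ ψ : ZMod (p ^ k) → ℂ,
      CatMap.IsHeckeEigenfunction hp r A ψ ∧ CatMap.l2Norm ψ = 1 ∧
        (p : ℝ) ^ (((k / 2 : ℕ) : ℝ) / 2) ≤ CatMap.supNorm ψ := by
  -- The largest admissible m is k / 2 (floor division), which gives the smallest support.
  have hm : 2 * (k / 2) ≤ k := Nat.mul_div_le k 2
  obtain ⟨ψ, hψ, hnorm, hsupp⟩ := CatMap.exists_heckeEigenfunction_supported hp r A hm
  refine ⟨ψ, hψ, hnorm, ?_⟩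
  have hp0 : (0 : ℝ) < p := by exact_mod_cast (Fact.out : p.Prime).pos
  have h1 := CatMap.card_le_card_support_mul_supNorm_sq hnorm
    (Finset.univ.filter fun x => x * (p : ZMod (p ^ k)) ^ (k - k / 2) = 0)
    (fun x hx => by simpa using hsupp x hx)
  have h2 : (p : ℝ) ^ k ≤ (p : ℝ) ^ (k - k / 2) * CatMap.supNorm ψ ^ 2 := by
    refine le_trans (by exact_mod_cast h1) ?_
    gcongr
    exact_mod_cast CatMap.card_annihilator_pow_le (Nat.div_le_self k 2)
  have h3 : (p : ℝ) ^ (k / 2) ≤ CatMap.supNorm ψ ^ 2 := by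
    refine le_of_mul_le_mul_left ?_ (pow_pos hp0 (k - k / 2))
    rwa [← pow_add, Nat.sub_add_cancel (Nat.div_le_self k 2)]
  -- Comparing squares removes the half in the real exponent and reduces the claim to `h3`.
  refine (sq_le_sq₀ (by positivity) ?_).mp ?_
  · exact Real.iSup_nonneg fun x => norm_nonneg (ψ x)
  · rwa [← Real.rpow_natCast (_ ^ _), ← Real.rpow_mul hp0.le, Nat.cast_ofNat, div_mul_cancel₀ _ two_ne_zero,
    Real.rpow_natCast]
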